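/- Let $D\subset\mathbb R^3$ be a bounded open set with Lipschitz boundary, equipped with the Euclidean metric and its Hodge operator $\star$. Let $L^2(\Lambda^1(D))$ be the real Hilbert space of square integrable 1-forms on $D$ with inner product $(\omega,\eta)=\int_D\omega\wedge\star\eta$, let $W^1(d,D)=\{\omega\in L^2(\Lambda^1(D)) : d\omega\in L^2\}$ with $d$ in the weak sense, and let $W^1_0(d,D)$ be the closure in $W^1(d,D)$, for the graph norm, of the smooth 1-forms with compact support in $D$. The operator $\star d$ (the curl, in terms of Euclidean vector proxies) is regarded as an unbounded operator on $L^2(\Lambda^1(D))$. For $\omega\in W^1(d,D)$ the natural trace $i^*\omega$ is the 1-current on $\partial D$ defined through Stokes' theorem by $$\int_{\partial D} i^*\omega\wedge i^*\varphi=\int_D \bigl(d\omega\wedge\varphi-\omega\wedge d\varphi\bigr)=(\star d\omega,\varphi)-(\omega,\star d\varphi)$$ for all smooth compactly supported 1-forms $\varphi$ on $\mathbb R^3$. Let $W^{-1/2,1}(d,\partial D)=i^*\bigl(W^1(d,D)\bigr)$ be the trace space, with the pairing $$[i^*\omega,i^*\eta]_{\partial D}=\int_{\partial D} i^*\omega\wedge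 i^*\eta:=(\star d\omega,\eta)-(\omega,\star d\eta),\qquad \omega,\eta\in W^1(d,D).$$ Theorem. This pairing is well defined on $W^{-1/2,1}(d,\partial D)$ and makes it a real symplectic space (that is, the pairing is bilinear, skew-symmetric and non-degenerate). For a linear subspace $L\subset W^{-1/2,1}(d,\partial D)$ let $L^\sharp=\{u : [u,v]_{\partial D}=0 \text{ for all } v\in L\}$, and call $L$ complete Lagrangian if $L^\sharp=L$. The mapping which associates to $L$ the operator $\star d$ with domain $$\{\eta\in W^1(d,D) : i^*\eta\in L\}$$ is a bijection from the set of complete Lagrangian subspaces of $W^{-1/2,1}(d,\partial D)$ onto the set of self-adjoint extensions of the operator $\star d$ with domain $W^1_0(d,D)$. -/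

import Mathlib

open scoped Distributions

namespace CurlGKN

noncomputable section

/-- Euclidean three-space. -/
abbrev R3 : Type := EuclideanSpace ℝ (Fin 3)

/-- An open set with Lipschitz boundary: near each boundary point, in suitable Cartesian
coordinates, it is the region above the graph of a Lipschitz function of two variables. -/
def HasLipschitzBoundary (D : TopologicalSpace.Opens R3) : Prop :=
  ∀ p ∈ frontier (D : Set R3),
    ∃ (e : R3 ≃ₗᵢ[ℝ] R3) (g : EuclideanSpace ℝ (Fin 2) → ℝ) (K : NNReal),
      LipschitzWith K g ∧ ∀ᶠ x in nhds p, x ∈ D ↔ g !₂[e x 0, e x 1] < e x 2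

/-! ### Differential forms in three-space and the operator `⋆d` on smooth forms

A 1-form on a subset of `R3` is represented by its Euclidean vector proxy, that is, the field `u`
stands for the form `x ↦ (v ↦ u x ⬝ v)`, and a 2-form by the field `w` that stands for
`x ↦ ((v₁, v₂) ↦ w x ⬝ (v₁ × v₂))`. The Hodge operator then leaves the proxies unchanged, `⋆d` on
1-forms is the curl, and `∫ ω ∧ ⋆η` is the `L²` inner product. -/

/-- The covector with vector proxy `u`. -/
def covector : R3 →L[ℝ] R3 [⋀^Fin 1]→L[ℝ] ℝ :=
  (ContinuousAlternatingMap.ofSubsingletonLIE (𝕜 := ℝ) (E := R3) (F := ℝ)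
    (0 : Fin 1)).toContinuousLinearEquiv.toContinuousLinearMap ∘L innerSL ℝ

/-- The unit coordinate vectors. -/
abbrev coordVec (i : Fin 3) : R3 := EuclideanSpace.single i 1

/-- The Euclidean Hodge operator from alternating 2-forms to (vector proxies of) 1-forms,
`⋆(dx₁∧dx₂) = dx₀`, `⋆(dx₂∧dx₀) = dx₁`, `⋆(dx₀∧dx₁) = dx₂`. -/
def starTwo (σ : R3 [⋀^Fin 2]→L[ℝ] ℝ) : R3 :=
  !₂[σ ![coordVec 1, coordVec 2], σ ![coordVec 2, coordVec 0], σ ![coordVec 0, coordVec 1]]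

/-- The curl of a vector field, as a linear function of its Jacobian. -/
def curlOfJacobian : (R3 →L[ℝ] R3) →L[ℝ] R3 :=
  LinearMap.toContinuousLinearMap
    { toFun := fun A => !₂[A (coordVec 1) 2 - A (coordVec 2) 1,
        A (coordVec 2) 0 - A (coordVec 0) 2, A (coordVec 0) 1 - A (coordVec 1) 0]
      map_add' := by
        intro A B
        ext i
        fin_cases i <;> simp <;> ring
      map_smul' := by
        intro c A
        ext i
        fin_cases i <;> simp <;> ring }

/-- On smooth 1-forms, the curl of the vector proxy is `⋆d`. -/
theorem starTwo_extDeriv_covector (u : R3 → R3) (x : R3) (hu : DifferentiableAt ℝ u x) :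
    starTwo (extDeriv (fun y => covector (u y)) x) = curlOfJacobian (fderiv ℝ u x) := by
  have h1 : DifferentiableAt ℝ (fun y => covector (u y)) x := by fun_prop
  have h2 : ∀ v w : R3, extDeriv (fun y => covector (u y)) x ![v, w]
      = inner ℝ (fderiv ℝ u x v) w - inner ℝ (fderiv ℝ u x w) v := by
    intro v w
    have h3 : fderiv ℝ (fun y => covector (u y)) x = covector ∘L fderiv ℝ u x :=
      (covector.hasFDerivAt.comp x hu.hasFDerivAt).fderiv
    rw [extDeriv, ContinuousAlternatingMap.alternatizeUncurryFin_apply, h3]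
    simp only [Fin.sum_univ_succ, covector]
    simp [Fin.removeNth, sub_eq_add_neg]
    rfl
  ext i
  fin_cases i <;> simp [starTwo, curlOfJacobian, h2, EuclideanSpace.inner_single_right]

/-- Smooth compactly supported 1-forms on the open set `Ω`. -/
abbrev TestForm (Ω : TopologicalSpace.Opens R3) : Type := 𝓓(Ω, R3)

/-- The operator `⋆d` on smooth compactly supported 1-forms. -/
def testStarD (Ω : TopologicalSpace.Opens R3) : TestForm Ω →ₗ[ℝ] TestForm Ω :=
  (TestFunction.postcompCLM curlOfJacobian ∘L TestFunction.fderivCLM ℝ ⊤ ⊤ :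
    𝓓(Ω, R3) →L[ℝ] 𝓓(Ω, R3)).toLinearMap

theorem testStarD_apply {Ω : TopologicalSpace.Opens R3} (φ : TestForm Ω) (x : R3) :
    testStarD Ω φ x = curlOfJacobian (fderiv ℝ φ x) := by
  simp [testStarD]

/-! ### Square integrable forms -/

/-- The real Hilbert space `L²(Λ¹(D))` of square integrable 1-forms on `D`. -/
abbrev L2Form (D : TopologicalSpace.Opens R3) : Type :=
  MeasureTheory.Lp R3 2 (MeasureTheory.volume.restrict (D : Set R3))

theorem memLp_testForm {Ω : TopologicalSpace.Opens R3} (D : TopologicalSpace.Opens R3)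
    (φ : TestForm Ω) :
    MeasureTheory.MemLp φ 2 (MeasureTheory.volume.restrict (D : Set R3)) :=
  φ.continuous.memLp_of_hasCompactSupport φ.hasCompactSupport

/-- The restriction to `D` of a smooth compactly supported 1-form, as an element of `L²(Λ¹(D))`. -/
def toL2 (Ω D : TopologicalSpace.Opens R3) : TestForm Ω →ₗ[ℝ] L2Form D where
  toFun φ := (memLp_testForm D φ).toLp φ
  map_add' _ _ := rfl
  map_smul' _ _ := rfl

/-- `w` is the weak `⋆d` of `u` on `D`: `(w, φ) = (u, ⋆dφ)` for all smooth 1-forms `φ` with compact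
support in `D`. -/
def IsWeakStarD (D : TopologicalSpace.Opens R3) (u w : L2Form D) : Prop :=
  ∀ φ : TestForm D, inner ℝ w (toL2 D D φ) = inner ℝ u (toL2 D D (testStarD D φ))

/-- The pairs `(u, w)` of square integrable 1-forms such that `w` is the weak `⋆d` of `u`. -/
def starDGraph (D : TopologicalSpace.Opens R3) : Submodule ℝ (L2Form D × L2Form D) where
  carrier := {p | IsWeakStarD D p.1 p.2}
  zero_mem' := by
    intro φ
    simp
  add_mem' := by
    intro p q hp hq φ
    simp only [Prod.fst_add, Prod.snd_add, inner_add_left, hp φ, hq φ]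
  smul_mem' := by
    intro c p hp φ
    simp only [Prod.smul_fst, Prod.smul_snd, real_inner_smul_left, hp φ]

theorem eq_zero_of_forall_inner_toL2 {D : TopologicalSpace.Opens R3} (w : L2Form D)
    (h : ∀ φ : TestForm D, inner ℝ w (toL2 D D φ) = 0) : w = 0 := by
  have hmem : MeasureTheory.MemLp w 2 (MeasureTheory.volume.restrict (D : Set R3)) :=
    MeasureTheory.Lp.memLp w
  have hloc : MeasureTheory.LocallyIntegrable w
      (MeasureTheory.volume.restrict (D : Set R3)) :=
    hmem.locallyIntegrable (by norm_num)
  have hae : ∀ᵐ x ∂(MeasureTheory.volume : MeasureTheory.Measure R3), x ∈ (D : Set R3) → w x = 0 := by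
    refine D.isOpen.ae_eq_zero_of_integral_contDiff_smul_eq_zero
      (MeasureTheory.locallyIntegrableOn_of_locallyIntegrable_restrict hloc) ?_
    intro g hg hgc hgs
    refine ext_inner_right ℝ fun v => ?_
    let φ : TestForm D :=
      ⟨fun x => g x • v, hg.smul contDiff_const, hgc.smul_right,
        (tsupport_smul_subset_left g _).trans hgs⟩
    have h1 := h φ
    have h2 : ∫ x in (D : Set R3), inner ℝ (w x) (g x • v) = 0 := by
      rw [← h1, MeasureTheory.L2.inner_def]
      refine MeasureTheory.integral_congr_ae ?_
      filter_upwards [(memLp_testForm D φ).coeFn_toLp] with x hx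
      have hx' : toL2 D D φ x = g x • v := hx
      rw [hx']
    have hint : MeasureTheory.IntegrableOn (fun x => g x • w x) (D : Set R3) :=
      hloc.integrable_smul_left_of_hasCompactSupport hg.continuous hgc
    have h3 : ∫ x, g x • w x = ∫ x in (D : Set R3), g x • w x := by
      refine (MeasureTheory.setIntegral_eq_integral_of_forall_compl_eq_zero fun x hx => ?_).symm
      rw [image_eq_zero_of_notMem_tsupport fun h => hx (hgs h), zero_smul]
    rw [h3, inner_zero_left, real_inner_comm, ← integral_inner hint, ← h2]
    refine MeasureTheory.integral_congr_ae (.of_forall fun x => ?_)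
    change inner ℝ v (g x • w x) = inner ℝ (w x) (g x • v)
    rw [real_inner_smul_right, real_inner_smul_right, real_inner_comm]
  rw [← MeasureTheory.ae_restrict_iff' D.isOpen.measurableSet] at hae
  exact (MeasureTheory.Lp.eq_zero_iff_ae_eq_zero).2 hae

/-- The weak `⋆d` is unique. -/
theorem starDGraph_unique (D : TopologicalSpace.Opens R3) (p : L2Form D × L2Form D)
    (hp : p ∈ starDGraph D) (h : p.1 = 0) : p.2 = 0 := by
  refine eq_zero_of_forall_inner_toL2 p.2 fun φ => ?_
  have h1 := hp φ
  rw [h1, h, inner_zero_left]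

/-- The maximal operator `⋆d`, an unbounded operator on `L²(Λ¹(D))` with domain `W¹(d, D)`. -/
def starD (D : TopologicalSpace.Opens R3) : L2Form D →ₗ.[ℝ] L2Form D :=
  (starDGraph D).toLinearPMap

/-- The Sobolev space `W¹(d, D)` of the square integrable 1-forms with square integrable exterior
derivative. -/
abbrev W1 (D : TopologicalSpace.Opens R3) : Submodule ℝ (L2Form D) := (starD D).domain

theorem starD_spec {D : TopologicalSpace.Opens R3} (u : W1 D) :
    IsWeakStarD D (u : L2Form D) (starD D u) :=
  Submodule.mem_graph_toLinearPMap (starDGraph_unique D) u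

theorem mem_W1_iff {D : TopologicalSpace.Opens R3} (u : L2Form D) :
    u ∈ W1 D ↔ ∃ w, IsWeakStarD D u w := by
  constructor
  · intro hu
    exact ⟨_, starD_spec ⟨u, hu⟩⟩
  · rintro ⟨w, hw⟩
    exact ⟨(u, w), hw, rfl⟩

/-- `W¹₀(d, D)`: the closure, in the graph norm, of the smooth 1-forms with compact support in `D`,
obtained from the closure of `{(φ, ⋆dφ)}` in `L² × L²`. -/
def W10 (D : TopologicalSpace.Opens R3) : Submodule ℝ (L2Form D) :=
  (LinearMap.range ((toL2 D D).prod (toL2 D D ∘ₗ testStarD D))).topologicalClosure.map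
    (LinearMap.fst ℝ (L2Form D) (L2Form D))

/-- The minimal operator: `⋆d` defined on `W¹₀(d, D)`. -/
def starDMin (D : TopologicalSpace.Opens R3) : L2Form D →ₗ.[ℝ] L2Form D :=
  (starD D).domRestrict (W10 D)

/-! ### Traces of 1-forms on the boundary -/

/-- The natural trace `i*ω` of `ω ∈ W¹(d, D)`, as a 1-current carried by `∂D`: by Stokes' theorem,
`∫_∂D i*ω ∧ i*φ = ∫_D (dω ∧ φ - ω ∧ dφ) = (⋆dω, φ) - (ω, ⋆dφ)` for all smooth 1-forms `φ`
of compact support in three-space. -/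
def trace (D : TopologicalSpace.Opens R3) : W1 D →ₗ[ℝ] (TestForm ⊤ →ₗ[ℝ] ℝ) :=
  LinearMap.mk₂ ℝ
    (fun ω φ => inner ℝ (starD D ω) (toL2 ⊤ D φ)
      - inner ℝ (ω : L2Form D) (toL2 ⊤ D (testStarD ⊤ φ)))
    (by intro a b φ; rw [LinearPMap.map_add, inner_add_left, Submodule.coe_add, inner_add_left]; ring)
    (by
      intro c a φ
      rw [LinearPMap.map_smul, real_inner_smul_left, Submodule.coe_smul, real_inner_smul_left]
      simp only [smul_eq_mul]; ring)
    (by intro a φ ψ; simp only [map_add, inner_add_right]; ring)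
    (by intro c a φ; simp only [map_smul, real_inner_smul_right, smul_eq_mul]; ring)

/-- The trace of a form is carried by the boundary. -/
theorem trace_apply_eq_zero {D : TopologicalSpace.Opens R3} (ω : W1 D) (φ : TestForm ⊤)
    (hφ : Disjoint (tsupport φ) (frontier (D : Set R3))) : trace D ω φ = 0 := by
  classical
  have hsub : closure (tsupport φ ∩ (D : Set R3)) ⊆ tsupport φ ∩ (D : Set R3) := by
    intro x hx
    have hx1 : x ∈ tsupport φ :=
      closure_minimal Set.inter_subset_left (isClosed_tsupport _) hx
    have hx2 : x ∈ closure (D : Set R3) := closure_mono Set.inter_subset_right hx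
    refine ⟨hx1, ?_⟩
    by_contra hxD
    exact Set.disjoint_left.1 hφ hx1 ⟨hx2, by rwa [D.isOpen.interior_eq]⟩
  have hloc : ∀ x, (D : Set R3).indicator φ =ᶠ[nhds x] φ ∨
      (D : Set R3).indicator φ =ᶠ[nhds x] 0 := by
    intro x
    by_cases hx : x ∈ (D : Set R3)
    · left
      filter_upwards [D.isOpen.mem_nhds hx] with y hy
      exact Set.indicator_of_mem hy _
    · right
      have hx' : x ∉ closure (tsupport φ ∩ (D : Set R3)) := fun h => hx (hsub h).2
      filter_upwards [isClosed_closure.isOpen_compl.mem_nhds hx'] with y hy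
      by_cases hyD : y ∈ (D : Set R3)
      · rw [Set.indicator_of_mem hyD]
        exact image_eq_zero_of_notMem_tsupport fun h => hy (subset_closure ⟨h, hyD⟩)
      · exact Set.indicator_of_notMem hyD _
  have hsupp : tsupport ((D : Set R3).indicator φ) ⊆ tsupport φ ∩ (D : Set R3) := by
    refine (closure_mono ?_).trans hsub
    rw [Set.support_indicator]
    exact fun x hx => ⟨subset_tsupport _ hx.2, hx.1⟩
  let ψ : TestForm D :=
    ⟨(D : Set R3).indicator φ, contDiff_iff_contDiffAt.2 fun x => by
        rcases hloc x with h | h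
        · exact φ.contDiff.contDiffAt.congr_of_eventuallyEq h
        · exact contDiffAt_const.congr_of_eventuallyEq h,
      φ.hasCompactSupport.of_isClosed_subset (isClosed_tsupport _)
        (hsupp.trans Set.inter_subset_left),
      hsupp.trans Set.inter_subset_right⟩
  have h1 : toL2 ⊤ D φ = toL2 D D ψ := by
    refine MeasureTheory.MemLp.toLp_congr (memLp_testForm D _) (memLp_testForm D _) ?_
    refine (MeasureTheory.ae_restrict_iff' D.isOpen.measurableSet).2 (.of_forall fun x hx => ?_)
    exact (Set.indicator_of_mem hx _).symm
  have h2 : toL2 ⊤ D (testStarD ⊤ φ) = toL2 D D (testStarD D ψ) := by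
    refine MeasureTheory.MemLp.toLp_congr (memLp_testForm D _) (memLp_testForm D _) ?_
    refine (MeasureTheory.ae_restrict_iff' D.isOpen.measurableSet).2 (.of_forall fun x hx => ?_)
    rw [testStarD_apply, testStarD_apply]
    congr 1
    refine Filter.EventuallyEq.fderiv_eq ?_
    filter_upwards [D.isOpen.mem_nhds hx] with y hy
    exact (Set.indicator_of_mem hy _).symm
  rw [trace, LinearMap.mk₂_apply, h1, h2, starD_spec ω ψ, sub_self]

/-- The trace space `W^{-1/2,1}(d, ∂D)`: all traces of forms in `W¹(d, D)`. -/
abbrev TraceSpace (D : TopologicalSpace.Opens R3) : Submodule ℝ (TestForm ⊤ →ₗ[ℝ] ℝ) :=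
  LinearMap.range (trace D)

/-- The trace map `i*` onto the trace space. -/
def traceMap (D : TopologicalSpace.Opens R3) : W1 D →ₗ[ℝ] TraceSpace D :=
  (trace D).rangeRestrict

/-- The boundary pairing of two forms on `D`, as given by Stokes' theorem,
`∫_∂D i*ω ∧ i*η = ∫_D (dω ∧ η - ω ∧ dη)`. -/
def stokesPairing (D : TopologicalSpace.Opens R3) (ω η : W1 D) : ℝ :=
  inner ℝ (starD D ω) (η : L2Form D) - inner ℝ (ω : L2Form D) (starD D η)

/-- The pairing `∫_∂D α ∧ β` of elements of the trace space, computed with forms on `D` that have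
the traces `α` and `β`. -/
def tracePairing (D : TopologicalSpace.Opens R3) (α β : TraceSpace D) : ℝ :=
  stokesPairing D α.2.choose β.2.choose

/-! ### Symplectic linear algebra -/

/-- `b` is a symplectic pairing on the real vector space `S`. -/
structure IsSymplecticPairing {S : Type*} [AddCommGroup S] [Module ℝ S] (b : S → S → ℝ) :
    Prop where
  linear : ∀ (s t : ℝ) (u v w : S), b (s • u + t • v) w = s * b u w + t * b v w
  skew : ∀ u v : S, b u v = -b v u
  nondegenerate : ∀ u : S, (∀ v : S, b u v = 0) → u = 0

/-- The symplectic orthogonal `L♯`. -/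
def sympOrthogonal {S : Type*} [AddCommGroup S] [Module ℝ S] (b : S → S → ℝ)
    (L : Submodule ℝ S) : Set S :=
  {u | ∀ v ∈ L, b u v = 0}

/-- A subspace `L` is Lagrangian if `L ⊆ L♯`, and complete if moreover `L♯ = L`. -/
def IsCompleteLagrangian {S : Type*} [AddCommGroup S] [Module ℝ S] (b : S → S → ℝ)
    (L : Submodule ℝ S) : Prop :=
  (L : Set S) ⊆ sympOrthogonal b L ∧ sympOrthogonal b L = L

/-! ### The operators belonging to subspaces of the trace space -/

/-- `{η ∈ W¹(d, D) : i*η ∈ L}`. -/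
def domainOf (D : TopologicalSpace.Opens R3) (L : Submodule ℝ (TraceSpace D)) :
    Submodule ℝ (L2Form D) :=
  (L.comap (traceMap D)).map (W1 D).subtype

/-- `⋆d` with domain `{η ∈ W¹(d, D) : i*η ∈ L}`. -/
def starDOf (D : TopologicalSpace.Opens R3) (L : Submodule ℝ (TraceSpace D)) :
    L2Form D →ₗ.[ℝ] L2Form D :=
  (starD D).domRestrict (domainOf D L)

/-- `A` is a self-adjoint extension of `T`. -/
def IsSelfAdjointExtension {H : Type*} [NormedAddCommGroup H] [InnerProductSpace ℝ H]
    [CompleteSpace H] (T A : H →ₗ.[ℝ] H) : Prop :=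
  T ≤ A ∧ IsSelfAdjoint A

end

end CurlGKN

namespace CurlGKN

open MeasureTheory Set Filter Topology
open scoped Pointwise Convolution ContDiff InnerProductSpace

/-! ### The weak curl of fields on three-space -/

/-! Everything rests on one analytic fact, `stokesPairing_eq_zero_of_trace_eq_zero`: a form with
zero trace pairs to zero with all of `W1 D`. Zero trace says that the extension by zero has a weak
curl on the whole space. A partition of unity cuts this extension into pieces, and the Lipschitz
condition allows the support of each piece to be translated into `D` by arbitrarily small vectors.
Mollifying a translated piece gives an admissible test field on `D`, so Green's formula holds for
it; since correlations of square integrable fields are continuous, the translation can tend to zero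
(`integral_inner_eq_of_translate`).

Hence the pairing descends to traces. It is non-degenerate because a trace is, by definition, the
Stokes pairing against restrictions of test forms, and these lie in `W1 D`.

The rest is linear algebra. The adjoint of an extension `A` of the minimal operator is a restriction
of the maximal one (`adjoint_le_starD`), and, when `A` itself lies below the maximal operator, the
adjoint domain is the annihilator of the domain of `A` under the Stokes pairing. For the operator
belonging to `L`, the adjoint domain is therefore the preimage of `L♯`, and self-adjointness means
`L♯ = L`. Conversely, the domain of a self-adjoint extension contains every form of zero trace,
since such a form annihilates everything; so the domain is the full preimage of its image under the
trace. Equality of `W10 D` with the kernel of the trace is never needed. -/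

/-- The cross product of a gradient, given as a covector, and a vector. -/
noncomputable def gradCross (l : R3 →L[ℝ] ℝ) (v : R3) : R3 := curlOfJacobian (l.smulRight v)

/-- Antisymmetry of the scalar triple product. It is what moves the product-rule term of a cut-off
from one factor to the other. -/
theorem inner_gradCross (l : R3 →L[ℝ] ℝ) (a b : R3) :
    ⟪gradCross l a, b⟫_ℝ = -⟪a, gradCross l b⟫_ℝ := by
  simp [gradCross, curlOfJacobian, PiLp.inner_apply, Fin.sum_univ_three]
  ring

theorem continuous_gradCross : Continuous fun p : (R3 →L[ℝ] ℝ) × R3 => gradCross p.1 p.2 := by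
  unfold gradCross
  exact curlOfJacobian.continuous.comp
    ((ContinuousLinearMap.smulRightL ℝ R3 R3).continuous₂)

theorem gradCross_zero (l : R3 →L[ℝ] ℝ) : gradCross l 0 = 0 := by
  rw [gradCross, ContinuousLinearMap.smulRight_zero, map_zero]

theorem norm_gradCross_le (l : R3 →L[ℝ] ℝ) (v : R3) :
    ‖gradCross l v‖ ≤ ‖curlOfJacobian‖ * ‖l‖ * ‖v‖ := by
  refine (curlOfJacobian.le_opNorm _).trans ?_
  rw [ContinuousLinearMap.norm_smulRight_apply, mul_assoc]

theorem gradCross_sum {ι : Type*} (s : Finset ι) (l : ι → R3 →L[ℝ] ℝ) (v : R3) :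
    gradCross (∑ i ∈ s, l i) v = ∑ i ∈ s, gradCross (l i) v := by
  unfold gradCross
  rw [← map_sum]
  congr 1
  ext x
  simp [Finset.sum_smul]

theorem curlOfJacobian_fderiv_smul {g : R3 → ℝ} {f : R3 → R3} {x : R3}
    (hg : DifferentiableAt ℝ g x) (hf : DifferentiableAt ℝ f x) :
    curlOfJacobian (fderiv ℝ (fun y => g y • f y) x)
      = g x • curlOfJacobian (fderiv ℝ f x) + gradCross (fderiv ℝ g x) (f x) := by
  rw [fderiv_fun_smul hg hf, map_add, map_smul]
  rfl

/-- `w` is the weak curl of `u` on the set `U`. -/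
def IsWeakCurl (U : Set R3) (u w : R3 → R3) : Prop :=
  ∀ φ : R3 → R3, ContDiff ℝ ∞ φ → HasCompactSupport φ → tsupport φ ⊆ U →
    ∫ x, ⟪w x, φ x⟫_ℝ = ∫ x, ⟪u x, curlOfJacobian (fderiv ℝ φ x)⟫_ℝ

theorem integrable_inner_of_memLp {u v : R3 → R3} (hu : MemLp u 2) (hv : MemLp v 2) :
    Integrable fun x => ⟪u x, v x⟫_ℝ :=
  (L2.integrable_inner (𝕜 := ℝ) (hu.toLp u) (hv.toLp v)).congr <| by
    filter_upwards [hu.coeFn_toLp, hv.coeFn_toLp] with x hx hy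
    rw [hx, hy]

theorem inner_toLp {u v : R3 → R3} (hu : MemLp u 2) (hv : MemLp v 2) :
    ⟪hu.toLp u, hv.toLp v⟫_ℝ = ∫ x, ⟪u x, v x⟫_ℝ := by
  rw [L2.inner_def]
  refine integral_congr_ae ?_
  filter_upwards [hu.coeFn_toLp, hv.coeFn_toLp] with x hx hy
  rw [hx, hy]

theorem memLp_smul {χ : R3 → ℝ} {φ : R3 → R3} (hχ : Continuous χ) (hφ : Continuous φ)
    (hc : HasCompactSupport φ) : MemLp (fun x => χ x • φ x) 2 :=
  (hχ.smul hφ).memLp_of_hasCompactSupport hc.smul_left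

/-- Multiplication of a field with a weak curl by a smooth function. -/
theorem IsWeakCurl.smul {u w : R3 → R3} (h : IsWeakCurl univ u w) (hu : MemLp u 2)
    (hw : MemLp w 2) {χ : R3 → ℝ} (hχ : ContDiff ℝ ∞ χ) :
    IsWeakCurl univ (fun x => χ x • u x)
      (fun x => χ x • w x + gradCross (fderiv ℝ χ x) (u x)) := by
  intro φ hφ hc _
  have hd1 : ContDiff ℝ ∞ fun x => χ x • φ x := hχ.smul hφ
  have hc1 : HasCompactSupport fun x => χ x • φ x := by
    refine HasCompactSupport.mono hc (Function.support_subset_iff'.2 fun x hx => ?_)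
    rw [Function.notMem_support.1 hx, smul_zero]
  -- The cut-off goes onto the test field. The term `gradCross (fderiv ℝ χ x) (φ x)` produced by the
  -- product rule cancels against the one that comes from `inner_gradCross`.
  have h1 := h (fun x => χ x • φ x) hd1 hc1 (subset_univ _)
  have hd : ∀ x, curlOfJacobian (fderiv ℝ (fun y => χ y • φ y) x)
      = χ x • curlOfJacobian (fderiv ℝ φ x) + gradCross (fderiv ℝ χ x) (φ x) := fun x =>
    curlOfJacobian_fderiv_smul (hχ.differentiable (by simp) x) (hφ.differentiable (by simp) x)
  have hχ' : Continuous (fderiv ℝ χ) := hχ.continuous_fderiv (by simp)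
  have hcont : Continuous fun x => gradCross (fderiv ℝ χ x) (φ x) :=
    continuous_gradCross.comp (hχ'.prodMk hφ.continuous)
  have hm1 : MemLp (fun x => χ x • φ x) 2 volume := memLp_smul hχ.continuous hφ.continuous hc
  have hm2 : MemLp (fun x => gradCross (fderiv ℝ χ x) (φ x)) 2 volume := by
    refine hcont.memLp_of_hasCompactSupport (HasCompactSupport.mono hc ?_)
    refine Function.support_subset_iff'.2 fun x hx => ?_
    rw [Function.notMem_support.1 hx, gradCross_zero]
  have hm3 : MemLp (fun x => χ x • curlOfJacobian (fderiv ℝ φ x)) 2 volume :=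
    memLp_smul hχ.continuous
      (curlOfJacobian.continuous.comp (hφ.continuous_fderiv (by simp)))
      ((hc.fderiv ℝ).comp_left (map_zero curlOfJacobian))
  have e1 : ∀ x, ⟪χ x • w x + gradCross (fderiv ℝ χ x) (u x), φ x⟫_ℝ
      = ⟪w x, χ x • φ x⟫_ℝ - ⟪u x, gradCross (fderiv ℝ χ x) (φ x)⟫_ℝ := fun x => by
    rw [inner_add_left, inner_gradCross, real_inner_smul_left, real_inner_smul_right]; ring
  have e2 : ∀ x, ⟪χ x • u x, curlOfJacobian (fderiv ℝ φ x)⟫_ℝ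
      = ⟪u x, χ x • curlOfJacobian (fderiv ℝ φ x)⟫_ℝ := fun x => by
    rw [real_inner_smul_left, real_inner_smul_right]
  simp only [e1, e2]
  rw [integral_sub (integrable_inner_of_memLp hw hm1) (integrable_inner_of_memLp hu hm2), h1]
  simp only [hd, inner_add_right]
  rw [integral_add (integrable_inner_of_memLp hu hm3) (integrable_inner_of_memLp hu hm2)]
  ring

/-! ### Correlations, mollification and Green's formula by translation -/

/-- The correlation of two square integrable fields is continuous. -/
theorem continuous_integral_inner_translate {u η : R3 → R3} (hu : MemLp u 2) (hη : MemLp η 2) :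
    Continuous fun y => ∫ x, ⟪u (x - y), η x⟫_ℝ := by
  -- Currying makes the translations a continuous family of measure-preserving maps, so translation
  -- is strongly continuous on `L²`.
  let g : C(R3, C(R3, R3)) := (ContinuousMap.mk (fun p : R3 × R3 => p.2 - p.1)
    (continuous_snd.sub continuous_fst)).curry
  have hg : ∀ y, MeasurePreserving (g y) (volume : Measure R3) volume := fun y =>
    measurePreserving_sub_right volume y
  have h1 : Continuous fun y => Lp.compMeasurePreserving (g y) (hg y) (hu.toLp u) :=
    Continuous.compMeasurePreservingLp continuous_const g.continuous hg (by simp)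
  have h2 : Continuous fun y =>
      ⟪Lp.compMeasurePreserving (g y) (hg y) (hu.toLp u), hη.toLp η⟫_ℝ :=
    h1.inner continuous_const
  refine h2.congr fun y => ?_
  rw [Lp.toLp_compMeasurePreserving, inner_toLp]
  rfl

/-- The integrability behind Fubini: by `ab ≤ a² + b²` the integrand is dominated by a convolution
integrand of two integrable functions plus a product of two integrable functions. -/
theorem integrable_correlation {u η : R3 → R3} (hu : MemLp u 2) (hη : MemLp η 2)
    {ρ : R3 → ℝ} (hρ : Continuous ρ) (hc : HasCompactSupport ρ) :
    Integrable (fun p : R3 × R3 => ρ p.2 * ⟪u (p.1 - p.2), η p.1⟫_ℝ)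
      ((volume : Measure R3).prod volume) := by
  have hρi : Integrable ρ := hρ.integrable_of_hasCompactSupport hc
  have hu2 : Integrable fun x => ‖u x‖ ^ 2 := hu.integrable_norm_pow (by norm_num)
  have hη2 : Integrable fun x => ‖η x‖ ^ 2 := hη.integrable_norm_pow (by norm_num)
  have h1 := hρi.norm.convolution_integrand (ContinuousLinearMap.mul ℝ ℝ) hu2
  have h2 := hη2.mul_prod hρi.norm
  have hmu : AEStronglyMeasurable (fun p : R3 × R3 => u (p.1 - p.2))
      ((volume : Measure R3).prod volume) :=
    hu.aestronglyMeasurable.comp_quasiMeasurePreserving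
      (quasiMeasurePreserving_sub_of_right_invariant volume volume)
  refine (h1.add h2).mono' ?_ (.of_forall fun p => ?_)
  · exact (hρ.comp continuous_snd).aestronglyMeasurable.mul
      (hmu.inner hη.aestronglyMeasurable.comp_fst)
  · simp only [norm_mul, Pi.add_apply, ContinuousLinearMap.mul_apply']
    have := norm_inner_le_norm (𝕜 := ℝ) (u (p.1 - p.2)) (η p.1)
    have h3 : ‖⟪u (p.1 - p.2), η p.1⟫_ℝ‖ ≤ ‖u (p.1 - p.2)‖ ^ 2 + ‖η p.1‖ ^ 2 := by
      nlinarith [sq_nonneg (‖u (p.1 - p.2)‖ - ‖η p.1‖), sq_nonneg (‖u (p.1 - p.2)‖),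
        sq_nonneg (‖η p.1‖)]
    nlinarith [norm_nonneg (ρ p.2)]

/-- By Fubini, averaging the correlation against `ρ` is the same as mollifying `u`; this links
translates of a field to smooth test fields. -/
theorem integral_mul_correlation {u η : R3 → R3} (hu : MemLp u 2) (hη : MemLp η 2)
    {ρ : R3 → ℝ} (hρ : Continuous ρ) (hc : HasCompactSupport ρ) :
    ∫ y, ρ y * ∫ x, ⟪u (x - y), η x⟫_ℝ
      = ∫ x, ⟪(ρ ⋆[ContinuousLinearMap.lsmul ℝ ℝ, volume] u) x, η x⟫_ℝ := by
  have h := integral_integral_swap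
    (f := fun x y => ρ y * ⟪u (x - y), η x⟫_ℝ) (integrable_correlation hu hη hρ hc)
  simp only [← integral_const_mul]
  rw [← h]
  refine integral_congr_ae (.of_forall fun x => ?_)
  have hex : Integrable fun y => ρ y • u (x - y) :=
    hc.convolutionExists_left (ContinuousLinearMap.lsmul ℝ ℝ) hρ
      (hu.locallyIntegrable (by norm_num)) x
  simp only [convolution_def, ContinuousLinearMap.lsmul_apply]
  rw [real_inner_comm, ← integral_inner hex]
  refine integral_congr_ae (.of_forall fun y => ?_)
  simp only [real_inner_smul_right, real_inner_comm]

/-- Mollification commutes with the weak curl. -/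
theorem curl_convolution {u w : R3 → R3} (h : IsWeakCurl univ u w) (hu : MemLp u 2)
    (hw : MemLp w 2) {ρ : R3 → ℝ} (hρ : ContDiff ℝ ∞ ρ) (hc : HasCompactSupport ρ) (x : R3) :
    curlOfJacobian (fderiv ℝ (ρ ⋆[ContinuousLinearMap.lsmul ℝ ℝ, volume] u) x)
      = (ρ ⋆[ContinuousLinearMap.lsmul ℝ ℝ, volume] w) x := by
  have hul : LocallyIntegrable u := hu.locallyIntegrable (by norm_num)
  have hwl : LocallyIntegrable w := hw.locallyIntegrable (by norm_num)
  have hρ1 : ContDiff ℝ 1 ρ := hρ.of_le (by simp)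
  rw [(hc.hasFDerivAt_convolution_left (ContinuousLinearMap.lsmul ℝ ℝ) hρ1 hul x).fderiv]
  have hex : Integrable fun y =>
      ((ContinuousLinearMap.lsmul ℝ ℝ : ℝ →L[ℝ] R3 →L[ℝ] R3).precompL R3) (fderiv ℝ ρ y)
        (u (x - y)) :=
    (hc.fderiv ℝ).convolutionExists_left _ (hρ1.continuous_fderiv (by simp)) hul x
  have hexw : Integrable fun y => ρ y • w (x - y) :=
    hc.convolutionExists_left (ContinuousLinearMap.lsmul ℝ ℝ) hρ.continuous hwl x
  have e : ∀ (l : R3 →L[ℝ] ℝ) (v : R3), curlOfJacobian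
      (((ContinuousLinearMap.lsmul ℝ ℝ : ℝ →L[ℝ] R3 →L[ℝ] R3).precompL R3) l v)
        = gradCross l v := fun l v => rfl
  rw [convolution_def, convolution_def, ← curlOfJacobian.integral_comp_comm hex]
  have hexc := curlOfJacobian.integrable_comp hex
  simp only [e] at hexc ⊢
  simp only [ContinuousLinearMap.lsmul_apply]
  refine ext_inner_left ℝ fun v => ?_
  rw [← integral_inner hexc, ← integral_inner hexw]
  have hφs : HasCompactSupport fun z => ρ (x - z) :=
    hc.comp_homeomorph (Homeomorph.subLeft x)
  have hφd : ContDiff ℝ ∞ fun z => ρ (x - z) := hρ.comp (contDiff_const.sub contDiff_id)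
  -- The reflected kernel times a constant vector `v` is the test field that picks out the
  -- `v`-component of the convolution at `x`.
  have h1 := h (fun z => ρ (x - z) • v) (hφd.smul contDiff_const) hφs.smul_right (subset_univ _)
  have hder : ∀ z, curlOfJacobian (fderiv ℝ (fun z => ρ (x - z) • v) z)
      = -gradCross (fderiv ℝ ρ (x - z)) v := fun z => by
    rw [curlOfJacobian_fderiv_smul (hφd.differentiable (by simp) z)
      (differentiableAt_const v)]
    have : fderiv ℝ (fun z => ρ (x - z)) z = -fderiv ℝ ρ (x - z) := by
      refine ((hρ.differentiable (by simp) (x - z)).hasFDerivAt.comp z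
        ((hasFDerivAt_id z).const_sub x)).fderiv.trans ?_
      ext; simp
    rw [this]
    simp only [fderiv_fun_const, Pi.zero_apply, map_zero, smul_zero, zero_add]
    unfold gradCross
    rw [← map_neg]
    congr 1
    ext; simp
  simp only [hder, inner_neg_right, ← inner_gradCross] at h1
  rw [← integral_sub_left_eq_self (fun y => ⟪v, gradCross (fderiv ℝ ρ y) (u (x - y))⟫_ℝ) volume x,
    ← integral_sub_left_eq_self (fun y => ⟪v, ρ y • w (x - y)⟫_ℝ) volume x]
  simp only [sub_sub_cancel]
  have hL : ∀ z, ⟪v, gradCross (fderiv ℝ ρ (x - z)) (u z)⟫_ℝ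
      = ⟪gradCross (fderiv ℝ ρ (x - z)) (u z), v⟫_ℝ := fun z => real_inner_comm _ _
  have hR : ∀ z, ⟪v, ρ (x - z) • w z⟫_ℝ = ⟪w z, ρ (x - z) • v⟫_ℝ := fun z => by
    rw [real_inner_smul_right, real_inner_smul_right, real_inner_comm]
  simp only [hL, hR, h1]

/-- Green's formula for a field that can be translated into the open set `U`. -/
theorem integral_inner_eq_of_translate {U K : Set R3} (hU : IsOpen U) (hK : IsCompact K)
    (hKU : (0 : R3) ∈ closure {y | ∀ x ∈ K, x + y ∈ U})
    {u w η ζ : R3 → R3} (h : IsWeakCurl univ u w) (hu : MemLp u 2) (hw : MemLp w 2)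
    (huK : ∀ x ∉ K, u x = 0)
    (h' : IsWeakCurl U η ζ) (hη : MemLp η 2) (hζ : MemLp ζ 2) :
    ∫ x, ⟪w x, η x⟫_ℝ = ∫ x, ⟪u x, ζ x⟫_ℝ := by
  set V : Set R3 := {y | ∀ x ∈ K, x + y ∈ U}
  have hV : IsOpen V := by
    refine isOpen_iff_mem_nhds.2 fun y hy => ?_
    refine hK.eventually_forall_of_forall_eventually (P := fun y x => x + y ∈ U) fun x hx => ?_
    exact (continuous_snd.add continuous_fst).continuousAt.eventually_mem
      (hU.mem_nhds (hy x hx))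
  set F : R3 → ℝ := fun y => (∫ x, ⟪w (x - y), η x⟫_ℝ) - ∫ x, ⟪u (x - y), ζ x⟫_ℝ with hF
  have hFc : Continuous F :=
    (continuous_integral_inner_translate hw hη).sub (continuous_integral_inner_translate hu hζ)
  -- For `ρ` supported in `V`, the mollification `ψ` of `u` is supported in `K + tsupport ρ ⊆ U`, so
  -- it may be inserted in the weak equation for `η`.
  have hae : ∀ᵐ y, y ∈ V → F y = 0 := by
    refine hV.ae_eq_zero_of_integral_contDiff_smul_eq_zero
      (hFc.locallyIntegrable.locallyIntegrableOn _) fun ρ hρ hρc hρV => ?_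
    set ψ : R3 → R3 := ρ ⋆[ContinuousLinearMap.lsmul ℝ ℝ, volume] u
    have hψd : ContDiff ℝ ∞ ψ := hρc.contDiff_convolution_left _ hρ
      (hu.locallyIntegrable (by norm_num))
    have hcomp : IsCompact (K + tsupport ρ) := hK.add hρc
    have hsub : tsupport ψ ⊆ K + tsupport ρ := by
      refine closure_minimal ((support_convolution_subset_swap _).trans
        (add_subset_add (fun x hx => ?_) subset_closure)) hcomp.isClosed
      by_contra hxK
      exact hx (huK x hxK)
    have hψc : HasCompactSupport ψ := hcomp.of_isClosed_subset (isClosed_tsupport _) hsub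
    have hψU : tsupport ψ ⊆ U := by
      refine hsub.trans ?_
      rintro _ ⟨x, hx, y, hy, rfl⟩
      exact hρV hy x hx
    have h1 := h' ψ hψd hψc hψU
    have h2 := integral_mul_correlation hw hη hρ.continuous hρc
    have h3 := integral_mul_correlation hu hζ hρ.continuous hρc
    have i1 : Integrable fun y => ρ y * ∫ x, ⟪w (x - y), η x⟫_ℝ :=
      (hρ.continuous.mul (continuous_integral_inner_translate hw hη)).integrable_of_hasCompactSupport
        hρc.mul_right
    have i2 : Integrable fun y => ρ y * ∫ x, ⟪u (x - y), ζ x⟫_ℝ :=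
      (hρ.continuous.mul (continuous_integral_inner_translate hu hζ)).integrable_of_hasCompactSupport
        hρc.mul_right
    simp only [hF, smul_eq_mul, mul_sub]
    rw [integral_sub i1 i2, h2, h3, sub_eq_zero]
    have e : ∀ x, curlOfJacobian (fderiv ℝ ψ x)
        = (ρ ⋆[ContinuousLinearMap.lsmul ℝ ℝ, volume] w) x :=
      curl_convolution h hu hw hρ hρc
    simp only [e] at h1
    simp only [real_inner_comm (η _), real_inner_comm (ζ _)]
    exact h1.symm
  -- Continuity turns almost everywhere into everywhere on `V`, and then carries the identity to the
  -- closure, which contains the zero translation.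
  have hF0 : EqOn F 0 (closure V) := by
    refine EqOn.closure ?_ hFc continuous_const
    refine Measure.eqOn_open_of_ae_eq (μ := volume) ?_ hV hFc.continuousOn continuousOn_const
    rwa [EventuallyEq, ae_restrict_iff' hV.measurableSet]
  have := hF0 hKU
  simpa [hF, sub_eq_zero] using this

end CurlGKN

namespace CurlGKN

open MeasureTheory Set Filter Topology
open scoped Pointwise Convolution ContDiff InnerProductSpace Manifold

/-! ### Domains with Lipschitz boundary -/

/-- Near each point of its closure, a Lipschitz domain contains small translates of its closure. -/
theorem HasLipschitzBoundary.exists_translate {D : TopologicalSpace.Opens R3}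
    (hD : HasLipschitzBoundary D) {p : R3} (hp : p ∈ closure (D : Set R3)) :
    ∃ r > 0, (0 : R3) ∈ closure {y | ∀ x ∈ Metric.ball p r ∩ closure (D : Set R3), x + y ∈ D} := by
  by_cases hpD : p ∈ (D : Set R3)
  · obtain ⟨r, hr, hrD⟩ := Metric.isOpen_iff.1 D.isOpen p hpD
    refine ⟨r, hr, subset_closure fun x hx => ?_⟩
    rw [add_zero]
    exact hrD hx.1
  · have hpf : p ∈ frontier (D : Set R3) := ⟨hp, by rwa [D.isOpen.interior_eq]⟩
    obtain ⟨e, g, K, hg, hev⟩ := hD p hpf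
    obtain ⟨r, hr, hrD⟩ := Metric.eventually_nhds_iff_ball.1 hev
    -- Half the radius, so that a shift of length below `r / 2` stays in the ball where the graph
    -- description holds.
    refine ⟨r / 2, half_pos hr, ?_⟩
    -- The upward direction of the local graph coordinates.
    set v : R3 := e.symm (coordVec 2) with hv
    have hvn : ‖v‖ = 1 := by simp [hv]
    have hlim : Tendsto (fun t : ℝ => t • v) (𝓝[>] 0) (𝓝 0) := by
      have : Tendsto (fun t : ℝ => t • v) (𝓝 0) (𝓝 ((0 : ℝ) • v)) :=
        (continuous_id.smul continuous_const).tendsto 0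
      rw [zero_smul] at this
      exact this.mono_left nhdsWithin_le_nhds
    refine mem_closure_of_tendsto hlim ?_
    filter_upwards [Ioo_mem_nhdsGT (half_pos hr)] with t ht x hx
    have hcont : Continuous fun z : R3 => g !₂[e z 0, e z 1] := by
      refine hg.continuous.comp ((PiLp.continuous_toLp 2 _).comp (continuous_pi fun i => ?_))
      fin_cases i
      · exact (EuclideanSpace.proj (0 : Fin 3)).continuous.comp e.continuous
      · exact (EuclideanSpace.proj (1 : Fin 3)).continuous.comp e.continuous
    have hcont2 : Continuous fun z : R3 => e z 2 :=
      (EuclideanSpace.proj (2 : Fin 3)).continuous.comp e.continuous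
    have hxr : x ∈ Metric.ball p r := Metric.ball_subset_ball (half_le_self hr.le) hx.1
    -- A point of the closure may lie on the graph itself; the upward shift makes the inequality
    -- strict.
    have hle : g !₂[e x 0, e x 1] ≤ e x 2 := by
      have hx' : x ∈ closure (Metric.ball p r ∩ (D : Set R3)) :=
        Metric.isOpen_ball.inter_closure ⟨hxr, hx.2⟩
      refine closure_minimal (t := {z : R3 | g !₂[e z 0, e z 1] ≤ e z 2}) (fun z hz => ?_)
        (isClosed_le hcont hcont2) hx'
      exact ((hrD z hz.1).1 hz.2).le
    have hball : x + t • v ∈ Metric.ball p r := by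
      have h1 := hx.1
      rw [Metric.mem_ball, dist_eq_norm] at h1 ⊢
      have h2 : ‖t • v‖ = t := by rw [norm_smul, hvn, mul_one, Real.norm_of_nonneg ht.1.le]
      calc ‖x + t • v - p‖ = ‖(x - p) + t • v‖ := by congr 1; abel
        _ ≤ ‖x - p‖ + ‖t • v‖ := norm_add_le _ _
        _ < r := by rw [h2]; linarith [ht.2]
    rw [hrD _ hball]
    have he : e (x + t • v) = e x + t • coordVec 2 := by
      rw [map_add, map_smul, hv, LinearIsometryEquiv.apply_symm_apply]
    have h0 : e (x + t • v) 0 = e x 0 := by rw [he]; simp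
    have h1 : e (x + t • v) 1 = e x 1 := by rw [he]; simp
    have h2 : e (x + t • v) 2 = e x 2 + t := by rw [he]; simp
    rw [h0, h1, h2]
    linarith [ht.1]

/-- A smooth partition of unity on a compact set, subordinate to balls. -/
theorem exists_finite_partition {K : Set R3} (hK : IsCompact K) {r : R3 → ℝ}
    (hr : ∀ p ∈ K, 0 < r p) :
    ∃ (s : Finset R3) (χ : R3 → R3 → ℝ), (∀ p ∈ s, p ∈ K) ∧ (∀ p ∈ s, ContDiff ℝ ∞ (χ p)) ∧
      (∀ p ∈ s, tsupport (χ p) ⊆ Metric.ball p (r p)) ∧ ∀ x ∈ K, ∑ p ∈ s, χ p x = 1 := by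
  classical
  obtain ⟨s, hsK, hs⟩ := hK.elim_nhds_subcover (fun p => Metric.ball p (r p))
    fun p hp => Metric.ball_mem_nhds p (hr p hp)
  obtain ⟨f, hf⟩ := SmoothPartitionOfUnity.exists_isSubordinate 𝓘(ℝ, R3) hK.isClosed
    (fun p : s => Metric.ball (p : R3) (r p)) (fun _ => Metric.isOpen_ball)
    (by rwa [iUnion_subtype])
  -- The value `0` off `s` only makes the family total.
  refine ⟨s, fun p => if h : p ∈ s then f ⟨p, h⟩ else 0, hsK, fun p hp => ?_, fun p hp => ?_,
    fun x hx => ?_⟩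
  · simp only [hp, dif_pos]
    exact (f ⟨p, hp⟩).contMDiff.contDiff
  · simp only [hp, dif_pos]
    exact hf ⟨p, hp⟩
  · have h1 := f.sum_eq_one hx
    rw [finsum_eq_sum_of_fintype] at h1
    rw [← h1, ← Finset.sum_coe_sort s]
    refine Finset.sum_congr rfl fun p _ => ?_
    simp

theorem memLp_smul_of_continuous {χ : R3 → ℝ} (hχ : Continuous χ) (hc : HasCompactSupport χ)
    {u : R3 → R3} (hu : MemLp u 2) : MemLp (fun x => χ x • u x) 2 := by
  obtain ⟨C, hC⟩ := hχ.bounded_above_of_compact_support hc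
  refine hu.of_le_mul (c := C) (hχ.aestronglyMeasurable.smul hu.aestronglyMeasurable)
    (.of_forall fun x => ?_)
  rw [norm_smul]
  exact mul_le_mul_of_nonneg_right (hC x) (norm_nonneg _)

theorem memLp_gradCross {χ : R3 → ℝ} (hχ : ContDiff ℝ ∞ χ) (hc : HasCompactSupport χ)
    {u : R3 → R3} (hu : MemLp u 2) : MemLp (fun x => gradCross (fderiv ℝ χ x) (u x)) 2 := by
  have hχ' : Continuous (fderiv ℝ χ) := hχ.continuous_fderiv (by simp)
  have hχc : HasCompactSupport (fderiv ℝ χ) := hc.fderiv ℝ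
  obtain ⟨C, hC⟩ := hχ'.bounded_above_of_compact_support hχc
  have hm : AEStronglyMeasurable (fun x => gradCross (fderiv ℝ χ x) (u x)) volume :=
    continuous_gradCross.comp_aestronglyMeasurable
      (f := fun x => (fderiv ℝ χ x, u x)) (hχ'.aestronglyMeasurable.prodMk hu.aestronglyMeasurable)
  have hle : ∀ x, ‖gradCross (fderiv ℝ χ x) (u x)‖ ≤ ‖curlOfJacobian‖ * C * ‖u x‖ := fun x =>
    (norm_gradCross_le _ _).trans (mul_le_mul_of_nonneg_right
      (mul_le_mul_of_nonneg_left (hC x) (ContinuousLinearMap.opNorm_nonneg _)) (norm_nonneg _))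
  exact hu.of_le_mul hm (.of_forall hle)

/-- Green's formula on a bounded Lipschitz domain, for a field whose extension by zero has a weak
curl on three-space. -/
theorem integral_inner_eq_of_lipschitz {D : TopologicalSpace.Opens R3}
    (hb : Bornology.IsBounded (D : Set R3)) (hL : HasLipschitzBoundary D)
    {u w η ζ : R3 → R3} (h : IsWeakCurl univ u w) (hu : MemLp u 2) (hw : MemLp w 2)
    (huD : ∀ x ∉ D, u x = 0) (hwD : ∀ x ∉ D, w x = 0)
    (h' : IsWeakCurl D η ζ) (hη : MemLp η 2) (hζ : MemLp ζ 2) :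
    ∫ x, ⟪w x, η x⟫_ℝ = ∫ x, ⟪u x, ζ x⟫_ℝ := by
  have hK : IsCompact (closure (D : Set R3)) := hb.isCompact_closure
  have hex : ∀ p, ∃ r : ℝ, p ∈ closure (D : Set R3) → 0 < r ∧ (0 : R3) ∈
      closure {y | ∀ x ∈ Metric.ball p r ∩ closure (D : Set R3), x + y ∈ D} := fun p => by
    by_cases hp : p ∈ closure (D : Set R3)
    · obtain ⟨r, h1, h2⟩ := hL.exists_translate hp
      exact ⟨r, fun _ => ⟨h1, h2⟩⟩
    · exact ⟨0, fun h => absurd h hp⟩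
  choose r hr using hex
  obtain ⟨s, χ, hsK, hχd, hχs, hχ1⟩ := exists_finite_partition hK fun p hp => (hr p hp).1
  have hχc : ∀ p ∈ s, HasCompactSupport (χ p) := fun p hp =>
    Metric.isCompact_of_isClosed_isBounded (isClosed_tsupport _)
      (Metric.isBounded_ball.subset (hχs p hp))
  have mu : ∀ p ∈ s, MemLp (fun x => χ p x • u x) 2 volume := fun p hp =>
    memLp_smul_of_continuous (hχd p hp).continuous (hχc p hp) hu
  have mw : ∀ p ∈ s, MemLp (fun x => χ p x • w x + gradCross (fderiv ℝ (χ p) x) (u x)) 2 volume :=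
    fun p hp => (memLp_smul_of_continuous (hχd p hp).continuous (hχc p hp) hw).add
      (memLp_gradCross (hχd p hp) (hχc p hp) hu)
  have key : ∀ p ∈ s, ∫ x, ⟪χ p x • w x + gradCross (fderiv ℝ (χ p) x) (u x), η x⟫_ℝ
      = ∫ x, ⟪χ p x • u x, ζ x⟫_ℝ := fun p hp => by
    -- Intersecting with the closure of `D` gives a compact set that still carries the cut-off field
    -- and lies in the region where the translation property holds.
    refine integral_inner_eq_of_translate (K := tsupport (χ p) ∩ closure (D : Set R3)) D.isOpen
      ((hχc p hp).isCompact.inter_right isClosed_closure) ?_ (h.smul hu hw (hχd p hp)) (mu p hp)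
      (mw p hp) (fun x hx => ?_) h' hη hζ
    · refine closure_mono ?_ (hr p (hsK p hp)).2
      exact fun y (hy : ∀ x ∈ _, x + y ∈ D) x hx => hy x ⟨hχs p hp hx.1, hx.2⟩
    · by_cases hxD : x ∈ D
      · have : χ p x = 0 := by
          by_contra h0
          exact hx ⟨subset_tsupport _ h0, subset_closure hxD⟩
        simp only [this, zero_smul]
      · simp only [huD x hxD, smul_zero]
  have e1 : ∀ x, ∑ p ∈ s, χ p x • u x = u x := fun x => by
    by_cases hxD : x ∈ D
    · rw [← Finset.sum_smul, hχ1 x (subset_closure hxD), one_smul]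
    · simp [huD x hxD]
  have e2 : ∀ x, ∑ p ∈ s, (χ p x • w x + gradCross (fderiv ℝ (χ p) x) (u x)) = w x := fun x => by
    by_cases hxD : x ∈ D
    · have hd : ∑ p ∈ s, fderiv ℝ (χ p) x = 0 := by
        rw [← fderiv_fun_sum fun p hp => (hχd p hp).differentiable (by simp) x]
        have : (fun y => ∑ p ∈ s, χ p y) =ᶠ[𝓝 x] fun _ => (1 : ℝ) := by
          filter_upwards [D.isOpen.mem_nhds hxD] with y hy
          exact hχ1 y (subset_closure hy)
        rw [this.fderiv_eq, fderiv_fun_const, Pi.zero_apply]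
      rw [Finset.sum_add_distrib, ← gradCross_sum, hd, ← Finset.sum_smul,
        hχ1 x (subset_closure hxD), one_smul]
      simp [gradCross]
    · simp [huD x hxD, hwD x hxD, gradCross_zero]
  calc ∫ x, ⟪w x, η x⟫_ℝ
      = ∑ p ∈ s, ∫ x, ⟪χ p x • w x + gradCross (fderiv ℝ (χ p) x) (u x), η x⟫_ℝ := by
        rw [← integral_finsetSum s fun p hp => integrable_inner_of_memLp (mw p hp) hη]
        simp only [← sum_inner, e2]
    _ = ∑ p ∈ s, ∫ x, ⟪χ p x • u x, ζ x⟫_ℝ := Finset.sum_congr rfl key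
    _ = ∫ x, ⟪u x, ζ x⟫_ℝ := by
        rw [← integral_finsetSum s fun p hp => integrable_inner_of_memLp (mu p hp) hζ]
        simp only [← sum_inner, e1]

/-! ### Integration by parts for smooth fields -/

theorem integral_mul_fderiv_coord {φ ψ : R3 → R3} (hφ : ContDiff ℝ ∞ φ) (hψ : ContDiff ℝ ∞ ψ)
    (hc : HasCompactSupport ψ) (v : R3) (i j : Fin 3) :
    Integrable (fun x => fderiv ℝ φ x v i * ψ x j) ∧
    Integrable (fun x => φ x i * fderiv ℝ ψ x v j) ∧
    ∫ x, φ x i * fderiv ℝ ψ x v j = -∫ x, fderiv ℝ φ x v i * ψ x j := by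
  have hd : ∀ {f : R3 → R3}, ContDiff ℝ ∞ f → ∀ (k : Fin 3) (x : R3),
      HasFDerivAt (fun y => f y k) ((EuclideanSpace.proj k : R3 →L[ℝ] ℝ) ∘L fderiv ℝ f x) x := fun hf k x =>
    (EuclideanSpace.proj k : R3 →L[ℝ] ℝ).hasFDerivAt.comp x
      (hf.differentiable (by simp) x).hasFDerivAt
  have hcj : ∀ {f : R3 → R3}, Continuous f → ∀ k : Fin 3, Continuous fun x => f x k :=
    fun hf k => (EuclideanSpace.proj k : R3 →L[ℝ] ℝ).continuous.comp hf
  have hcd : ∀ {f : R3 → R3}, ContDiff ℝ ∞ f → Continuous fun x => fderiv ℝ f x v := fun hf =>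
    (hf.continuous_fderiv (by simp)).clm_apply continuous_const
  have s1 : HasCompactSupport fun x => ψ x j :=
    hc.comp_left (g := fun y : R3 => y j) rfl
  have s2 : HasCompactSupport fun x => fderiv ℝ ψ x v j :=
    (hc.fderiv ℝ).comp_left (g := fun A : R3 →L[ℝ] R3 => A v j) rfl
  have i1 : Integrable (fun x => fderiv ℝ φ x v i * ψ x j) :=
    ((hcj (hcd hφ) i).mul (hcj hψ.continuous j)).integrable_of_hasCompactSupport s1.mul_left
  have i2 : Integrable (fun x => φ x i * fderiv ℝ ψ x v j) :=
    ((hcj hφ.continuous i).mul (hcj (hcd hψ) j)).integrable_of_hasCompactSupport s2.mul_left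
  have i3 : Integrable (fun x => φ x i * ψ x j) :=
    ((hcj hφ.continuous i).mul (hcj hψ.continuous j)).integrable_of_hasCompactSupport s1.mul_left
  have h := integral_mul_fderiv_eq_neg_fderiv_mul_of_integrable (μ := (volume : Measure R3))
    (f := fun x => φ x i) (g := fun x => ψ x j) (v := v)
    (by simp only [(hd hφ i _).fderiv]; exact i1) (by simp only [(hd hψ j _).fderiv]; exact i2) i3
    (fun x _ => (hd hφ i x).differentiableAt) (fun x _ => (hd hψ j x).differentiableAt)
  simp only [(hd hφ i _).fderiv, (hd hψ j _).fderiv] at h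
  exact ⟨i1, i2, h⟩

theorem integral_sub_add_sub_add_sub {f₁ f₂ f₃ f₄ f₅ f₆ : R3 → ℝ} (h₁ : Integrable f₁)
    (h₂ : Integrable f₂) (h₃ : Integrable f₃) (h₄ : Integrable f₄) (h₅ : Integrable f₅)
    (h₆ : Integrable f₆) :
    ∫ x, ((f₁ x - f₂ x) + (f₃ x - f₄ x)) + (f₅ x - f₆ x)
      = ((∫ x, f₁ x) - (∫ x, f₂ x) + ((∫ x, f₃ x) - ∫ x, f₄ x)) + ((∫ x, f₅ x) - ∫ x, f₆ x) := by
  have h12 : Integrable fun x => f₁ x - f₂ x := h₁.sub h₂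
  have h34 : Integrable fun x => f₃ x - f₄ x := h₃.sub h₄
  have h56 : Integrable fun x => f₅ x - f₆ x := h₅.sub h₆
  have h1234 : Integrable fun x => (f₁ x - f₂ x) + (f₃ x - f₄ x) := h12.add h34
  rw [integral_add h1234 h56, integral_add h12 h34, integral_sub h₁ h₂, integral_sub h₃ h₄,
    integral_sub h₅ h₆]

/-- Green's formula for smooth fields. -/
theorem integral_inner_curl {φ ψ : R3 → R3} (hφ : ContDiff ℝ ∞ φ) (hψ : ContDiff ℝ ∞ ψ)
    (hc : HasCompactSupport ψ) :
    ∫ x, ⟪curlOfJacobian (fderiv ℝ φ x), ψ x⟫_ℝ = ∫ x, ⟪φ x, curlOfJacobian (fderiv ℝ ψ x)⟫_ℝ := by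
  have H := fun i j k => integral_mul_fderiv_coord hφ hψ hc (coordVec k) i j
  have e1 : ∀ x, ⟪curlOfJacobian (fderiv ℝ φ x), ψ x⟫_ℝ
      = ((fderiv ℝ φ x (coordVec 1) 2 * ψ x 0 - fderiv ℝ φ x (coordVec 2) 1 * ψ x 0)
        + (fderiv ℝ φ x (coordVec 2) 0 * ψ x 1 - fderiv ℝ φ x (coordVec 0) 2 * ψ x 1))
        + (fderiv ℝ φ x (coordVec 0) 1 * ψ x 2 - fderiv ℝ φ x (coordVec 1) 0 * ψ x 2) := by
    intro x
    simp [curlOfJacobian, PiLp.inner_apply, Fin.sum_univ_three]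
    ring
  have e2 : ∀ x, ⟪φ x, curlOfJacobian (fderiv ℝ ψ x)⟫_ℝ
      = ((φ x 0 * fderiv ℝ ψ x (coordVec 1) 2 - φ x 0 * fderiv ℝ ψ x (coordVec 2) 1)
        + (φ x 1 * fderiv ℝ ψ x (coordVec 2) 0 - φ x 1 * fderiv ℝ ψ x (coordVec 0) 2))
        + (φ x 2 * fderiv ℝ ψ x (coordVec 0) 1 - φ x 2 * fderiv ℝ ψ x (coordVec 1) 0) := by
    intro x
    simp [curlOfJacobian, PiLp.inner_apply, Fin.sum_univ_three]
    ring
  simp only [e1, e2]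
  -- Each of the six terms is integrated by parts on its own; the signs from integration by parts
  -- match the antisymmetry of the curl.
  rw [integral_sub_add_sub_add_sub (H 2 0 1).1 (H 1 0 2).1 (H 0 1 2).1 (H 2 1 0).1 (H 1 2 0).1
      (H 0 2 1).1,
    integral_sub_add_sub_add_sub (H 0 2 1).2.1 (H 0 1 2).2.1 (H 1 0 2).2.1 (H 1 2 0).2.1
      (H 2 1 0).2.1 (H 2 0 1).2.1,
    (H 0 2 1).2.2, (H 0 1 2).2.2, (H 1 0 2).2.2, (H 1 2 0).2.2, (H 2 1 0).2.2, (H 2 0 1).2.2]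
  ring

end CurlGKN

namespace CurlGKN

open MeasureTheory Set Filter Topology
open scoped InnerProductSpace

/-! ### The trace and the boundary pairing -/

variable {D : TopologicalSpace.Opens R3}

/-- Extension by zero of a form on `D`. -/
noncomputable def extendZero (u : L2Form D) : R3 → R3 := (D : Set R3).indicator u

theorem memLp_extendZero (u : L2Form D) : MemLp (extendZero u) 2 :=
  (memLp_indicator_iff_restrict D.isOpen.measurableSet).2 (Lp.memLp u)

theorem extendZero_of_notMem (u : L2Form D) {x : R3} (hx : x ∉ D) : extendZero u x = 0 :=
  indicator_of_notMem hx _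

theorem integral_extendZero_inner (u : L2Form D) (f : R3 → R3) :
    ∫ x, ⟪extendZero u x, f x⟫_ℝ = ∫ x in (D : Set R3), ⟪u x, f x⟫_ℝ := by
  rw [← integral_indicator D.isOpen.measurableSet]
  refine integral_congr_ae (.of_forall fun x => ?_)
  by_cases hx : x ∈ (D : Set R3)
  · simp only [extendZero, indicator_of_mem hx]
  · simp only [extendZero, indicator_of_notMem hx, inner_zero_left]

theorem inner_eq_integral_extendZero (u v : L2Form D) :
    ⟪u, v⟫_ℝ = ∫ x, ⟪extendZero u x, extendZero v x⟫_ℝ := by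
  rw [integral_extendZero_inner, L2.inner_def]
  refine setIntegral_congr_fun D.isOpen.measurableSet fun x hx => ?_
  simp only [extendZero, indicator_of_mem hx]

theorem inner_toL2 {Ω : TopologicalSpace.Opens R3} (u : L2Form D) (φ : TestForm Ω) :
    ⟪u, toL2 Ω D φ⟫_ℝ = ∫ x, ⟪extendZero u x, φ x⟫_ℝ := by
  rw [integral_extendZero_inner, L2.inner_def]
  refine integral_congr_ae ?_
  filter_upwards [(memLp_testForm D φ).coeFn_toLp] with x hx
  have hx' : toL2 Ω D φ x = φ x := hx
  rw [hx']

theorem inner_toL2_testStarD {Ω : TopologicalSpace.Opens R3} (u : L2Form D) (φ : TestForm Ω) :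
    ⟪u, toL2 Ω D (testStarD Ω φ)⟫_ℝ
      = ∫ x, ⟪extendZero u x, curlOfJacobian (fderiv ℝ φ x)⟫_ℝ := by
  simp only [inner_toL2, testStarD_apply]

theorem IsWeakStarD.isWeakCurl {u w : L2Form D} (h : IsWeakStarD D u w) :
    IsWeakCurl D (extendZero u) (extendZero w) := by
  intro φ hφ hc hs
  have h1 := h ⟨φ, hφ, hc, hs⟩
  rwa [inner_toL2, inner_toL2_testStarD] at h1

theorem trace_apply (ω : W1 D) (φ : TestForm ⊤) :
    trace D ω φ = ⟪starD D ω, toL2 ⊤ D φ⟫_ℝ - ⟪(ω : L2Form D), toL2 ⊤ D (testStarD ⊤ φ)⟫_ℝ :=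
  rfl

/-- The trace is the defect in the weak curl equation when the test form need not vanish near the
boundary; without it, extension by zero creates no surface term. -/
theorem isWeakCurl_univ_of_trace_eq_zero {ω : W1 D} (h : trace D ω = 0) :
    IsWeakCurl univ (extendZero (ω : L2Form D)) (extendZero (starD D ω)) := by
  intro φ hφ hc _
  have h1 : trace D ω ⟨φ, hφ, hc, subset_univ _⟩ = 0 := by rw [h]; rfl
  rw [trace_apply, sub_eq_zero, inner_toL2, inner_toL2_testStarD] at h1
  exact h1

/-- Forms with vanishing trace pair to zero with all forms. -/
theorem stokesPairing_eq_zero_of_trace_eq_zero (hb : Bornology.IsBounded (D : Set R3))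
    (hL : HasLipschitzBoundary D) {ω : W1 D} (h : trace D ω = 0) (η : W1 D) :
    stokesPairing D ω η = 0 := by
  rw [stokesPairing, sub_eq_zero, inner_eq_integral_extendZero, inner_eq_integral_extendZero]
  exact integral_inner_eq_of_lipschitz hb hL (isWeakCurl_univ_of_trace_eq_zero h)
    (memLp_extendZero _) (memLp_extendZero _) (fun x hx => extendZero_of_notMem _ hx)
    (fun x hx => extendZero_of_notMem _ hx) (starD_spec η).isWeakCurl (memLp_extendZero _)
    (memLp_extendZero _)

theorem starD_eq_of_isWeakStarD (u : W1 D) {w : L2Form D} (h : IsWeakStarD D u w) :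
    starD D u = w := by
  have h1 := starDGraph_unique D ((u : L2Form D) - u, starD D u - w)
    ((starDGraph D).sub_mem (x := ((u : L2Form D), starD D u)) (y := ((u : L2Form D), w))
      (starD_spec u) h) (sub_self _)
  exact sub_eq_zero.1 h1

theorem inner_toL2_toL2 {Ω : TopologicalSpace.Opens R3} (φ : TestForm Ω) (ψ : TestForm D) :
    ⟪toL2 Ω D φ, toL2 D D ψ⟫_ℝ = ∫ x, ⟪φ x, ψ x⟫_ℝ := by
  rw [L2.inner_def]
  trans ∫ x in (D : Set R3), ⟪φ x, ψ x⟫_ℝ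
  · refine integral_congr_ae ?_
    filter_upwards [(memLp_testForm D φ).coeFn_toLp, (memLp_testForm D ψ).coeFn_toLp] with x hx hy
    have hx' : toL2 Ω D φ x = φ x := hx
    have hy' : toL2 D D ψ x = ψ x := hy
    rw [hx', hy']
  · refine setIntegral_eq_integral_of_forall_compl_eq_zero fun x hx => ?_
    rw [image_eq_zero_of_notMem_tsupport fun h => hx (ψ.tsupport_subset h), inner_zero_right]

/-- Smooth forms belong to `W¹(d, D)`. -/
theorem isWeakStarD_toL2 {Ω : TopologicalSpace.Opens R3} (φ : TestForm Ω) :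
    IsWeakStarD D (toL2 Ω D φ) (toL2 Ω D (testStarD Ω φ)) := by
  intro ψ
  rw [inner_toL2_toL2, inner_toL2_toL2]
  simp only [testStarD_apply]
  exact integral_inner_curl φ.contDiff ψ.contDiff ψ.hasCompactSupport

end CurlGKN

namespace CurlGKN

open MeasureTheory Set Filter Topology
open scoped InnerProductSpace

variable {D : TopologicalSpace.Opens R3}

/-! ### The symplectic structure on the trace space -/

theorem toL2_mem_W1 {Ω : TopologicalSpace.Opens R3} (φ : TestForm Ω) : toL2 Ω D φ ∈ W1 D :=
  (mem_W1_iff _).2 ⟨_, isWeakStarD_toL2 φ⟩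

theorem starD_toL2 {Ω : TopologicalSpace.Opens R3} (φ : TestForm Ω) :
    starD D ⟨toL2 Ω D φ, toL2_mem_W1 φ⟩ = toL2 Ω D (testStarD Ω φ) :=
  starD_eq_of_isWeakStarD _ (isWeakStarD_toL2 φ)

theorem trace_apply_eq_stokesPairing (ω : W1 D) (φ : TestForm ⊤) :
    trace D ω φ = stokesPairing D ω ⟨toL2 ⊤ D φ, toL2_mem_W1 φ⟩ := by
  rw [trace_apply, stokesPairing, starD_toL2]

/-- Non-degeneracy needs only those `η` that are restrictions of test forms on the whole space. -/
theorem trace_eq_zero_of_stokesPairing {ω : W1 D} (h : ∀ η, stokesPairing D ω η = 0) :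
    trace D ω = 0 := by
  ext φ
  rw [trace_apply_eq_stokesPairing, h]
  rfl

theorem stokesPairing_linear (s t : ℝ) (u v w : W1 D) :
    stokesPairing D (s • u + t • v) w = s * stokesPairing D u w + t * stokesPairing D v w := by
  simp only [stokesPairing, LinearPMap.map_add, LinearPMap.map_smul, Submodule.coe_add,
    Submodule.coe_smul, inner_add_left, real_inner_smul_left]
  ring

theorem stokesPairing_skew (u v : W1 D) : stokesPairing D u v = -stokesPairing D v u := by
  simp only [stokesPairing, real_inner_comm (v : L2Form D), real_inner_comm (starD D v)]
  ring

/-- Linearity and the vanishing for zero trace treat the first argument; skew-symmetry transfers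
this to the second. It makes the choice of representatives in `tracePairing` immaterial. -/
theorem stokesPairing_congr (hb : Bornology.IsBounded (D : Set R3))
    (hL : HasLipschitzBoundary D) {ω ω' η η' : W1 D} (h : trace D ω = trace D ω')
    (h' : trace D η = trace D η') : stokesPairing D ω η = stokesPairing D ω' η' := by
  have aux : ∀ {a b : W1 D}, trace D a = trace D b → ∀ c,
      stokesPairing D a c = stokesPairing D b c := fun {a b} hab c => by
    have h0 := stokesPairing_eq_zero_of_trace_eq_zero hb hL (ω := (1 : ℝ) • a + (-1 : ℝ) • b)
      (by rw [one_smul, neg_smul, one_smul, ← sub_eq_add_neg, map_sub, hab, sub_self]) c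
    rw [stokesPairing_linear] at h0
    linarith
  rw [aux h, stokesPairing_skew, aux h', ← stokesPairing_skew]

theorem tracePairing_traceMap (hb : Bornology.IsBounded (D : Set R3))
    (hL : HasLipschitzBoundary D) (ω η : W1 D) :
    tracePairing D (traceMap D ω) (traceMap D η) = stokesPairing D ω η :=
  stokesPairing_congr hb hL (traceMap D ω).2.choose_spec (traceMap D η).2.choose_spec

theorem traceMap_surjective : Function.Surjective (traceMap D) :=
  (trace D).surjective_rangeRestrict

theorem traceMap_eq_zero_iff {ω : W1 D} : traceMap D ω = 0 ↔ trace D ω = 0 :=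
  Subtype.ext_iff

theorem isSymplecticPairing_tracePairing (hb : Bornology.IsBounded (D : Set R3))
    (hL : HasLipschitzBoundary D) : IsSymplecticPairing (tracePairing D) where
  linear s t u v w := by
    obtain ⟨u, rfl⟩ := traceMap_surjective u
    obtain ⟨v, rfl⟩ := traceMap_surjective v
    obtain ⟨w, rfl⟩ := traceMap_surjective w
    rw [← map_smul, ← map_smul, ← map_add]
    simp only [tracePairing_traceMap hb hL, stokesPairing_linear]
  skew u v := by
    obtain ⟨u, rfl⟩ := traceMap_surjective u
    obtain ⟨v, rfl⟩ := traceMap_surjective v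
    simp only [tracePairing_traceMap hb hL]
    exact stokesPairing_skew u v
  nondegenerate u h := by
    obtain ⟨u, rfl⟩ := traceMap_surjective u
    refine traceMap_eq_zero_iff.2 (trace_eq_zero_of_stokesPairing fun η => ?_)
    rw [← tracePairing_traceMap hb hL, h]

/-! ### Extensions of the minimal operator -/

/-- The range of the test forms is dense in `L²`. -/
theorem dense_range_toL2 : Dense (LinearMap.range (toL2 D D) : Set (L2Form D)) := by
  rw [Submodule.dense_iff_topologicalClosure_eq_top, Submodule.topologicalClosure_eq_top_iff,
    Submodule.eq_bot_iff]
  intro w hw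
  refine eq_zero_of_forall_inner_toL2 w fun φ => ?_
  rw [real_inner_comm]
  exact hw _ ⟨φ, rfl⟩

theorem toL2_mem_W10 (φ : TestForm D) : toL2 D D φ ∈ W10 D :=
  ⟨(toL2 D D φ, toL2 D D (testStarD D φ)), Submodule.le_topologicalClosure _ ⟨φ, rfl⟩, rfl⟩

/-- The elements of `W¹₀(d, D)` have weak `⋆d` and vanishing trace. -/
theorem exists_of_mem_W10 {u : L2Form D} (hu : u ∈ W10 D) :
    ∃ w, IsWeakStarD D u w ∧
      ∀ φ : TestForm ⊤, ⟪w, toL2 ⊤ D φ⟫_ℝ = ⟪u, toL2 ⊤ D (testStarD ⊤ φ)⟫_ℝ := by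
  obtain ⟨⟨u', w⟩, hp, rfl⟩ := hu
  -- For fixed `a` and `b` the identity is a closed condition on the pair, so it passes from test
  -- forms to their graph closure. It is used once with test forms on `D` and once with restrictions
  -- of global ones.
  have key : ∀ a b : L2Form D, (∀ ψ : TestForm D,
      ⟪toL2 D D (testStarD D ψ), a⟫_ℝ = ⟪toL2 D D ψ, b⟫_ℝ) → ⟪w, a⟫_ℝ = ⟪u', b⟫_ℝ := by
    intro a b hab
    have hcl : IsClosed {p : L2Form D × L2Form D | ⟪p.2, a⟫_ℝ = ⟪p.1, b⟫_ℝ} :=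
      isClosed_eq (continuous_snd.inner continuous_const) (continuous_fst.inner continuous_const)
    refine closure_minimal ?_ hcl hp
    rintro _ ⟨ψ, rfl⟩
    exact hab ψ
  refine ⟨w, fun φ => key _ _ fun ψ => isWeakStarD_toL2 ψ φ, fun φ => key _ _ fun ψ => ?_⟩
  rw [real_inner_comm, real_inner_comm (toL2 ⊤ D _)]
  exact (isWeakStarD_toL2 φ ψ).symm

theorem W10_le_W1 : W10 D ≤ W1 D := fun u hu =>
  let ⟨w, hw, _⟩ := exists_of_mem_W10 hu
  (mem_W1_iff u).2 ⟨w, hw⟩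

theorem trace_eq_zero_of_mem_W10 {ω : W1 D} (h : (ω : L2Form D) ∈ W10 D) : trace D ω = 0 := by
  obtain ⟨w, hw, hφ⟩ := exists_of_mem_W10 h
  ext φ
  rw [trace_apply, starD_eq_of_isWeakStarD ω hw, hφ, sub_self]
  rfl

theorem mem_domainOf {L : Submodule ℝ (TraceSpace D)} {u : L2Form D} :
    u ∈ domainOf D L ↔ ∃ h : u ∈ W1 D, traceMap D ⟨u, h⟩ ∈ L := by
  simp [domainOf]

theorem domainOf_le (L : Submodule ℝ (TraceSpace D)) : domainOf D L ≤ W1 D :=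
  Submodule.map_subtype_le _ _

theorem W10_le_domainOf (L : Submodule ℝ (TraceSpace D)) : W10 D ≤ domainOf D L := fun u hu =>
  mem_domainOf.2 ⟨W10_le_W1 hu, by
    rw [traceMap_eq_zero_iff.2 (trace_eq_zero_of_mem_W10 hu)]
    exact L.zero_mem⟩

theorem dense_of_W10_le {M : Submodule ℝ (L2Form D)} (h : W10 D ≤ M) :
    Dense (M : Set (L2Form D)) :=
  dense_range_toL2.mono <| by
    rintro _ ⟨φ, rfl⟩
    exact h (toL2_mem_W10 φ)

/-- `domRestrict` intersects the prescribed subspace with the original domain, and here the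
intersection loses nothing. -/
theorem starDOf_domain (L : Submodule ℝ (TraceSpace D)) : (starDOf D L).domain = domainOf D L :=
  inf_eq_left.2 (domainOf_le L)

theorem starDMin_domain : (starDMin D).domain = W10 D := inf_eq_left.2 W10_le_W1

theorem dense_domain_of_starDMin_le {A : L2Form D →ₗ.[ℝ] L2Form D} (hA : starDMin D ≤ A) :
    Dense (A.domain : Set (L2Form D)) :=
  dense_of_W10_le (starDMin_domain.symm.trans_le hA.1)

open LinearPMap in
/-- The adjoint of an extension of the minimal operator is a restriction of the maximal one. -/
theorem adjoint_le_starD {A : L2Form D →ₗ.[ℝ] L2Form D} (hA : starDMin D ≤ A) :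
    A† ≤ starD D := by
  -- The adjoint relation tested on forms with compact support in `D` is the weak equation for `⋆d`.
  have hweak : ∀ u : A†.domain, IsWeakStarD D (u : L2Form D) (A† u) := fun u φ => by
    have hmin : toL2 D D φ ∈ (starDMin D).domain := starDMin_domain.symm ▸ toL2_mem_W10 φ
    have h1 := adjoint_isFormalAdjoint (dense_domain_of_starDMin_le hA) u ⟨_, hA.1 hmin⟩
    have h2 : A ⟨_, hA.1 hmin⟩ = toL2 D D (testStarD D φ) := by
      rw [← hA.2 (x := ⟨_, hmin⟩) rfl, ← starD_toL2]
      exact LinearPMap.domRestrict_apply rfl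
    rw [h2] at h1
    exact h1
  refine ⟨fun u hu => (mem_W1_iff u).2 ⟨_, hweak ⟨u, hu⟩⟩, fun u v huv => ?_⟩
  refine (starD_eq_of_isWeakStarD v ?_).symm
  rw [← huv]
  exact hweak u

open LinearPMap in
/-- The domain of the adjoint of an operator between the minimal and the maximal one. -/
theorem mem_adjoint_domain_iff_stokesPairing {A : L2Form D →ₗ.[ℝ] L2Form D}
    (hA : starDMin D ≤ A) (hA' : A ≤ starD D) (ω : W1 D) :
    (ω : L2Form D) ∈ A†.domain ↔ ∀ η : W1 D, (η : L2Form D) ∈ A.domain →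
      stokesPairing D ω η = 0 := by
  constructor
  · intro h η hη
    have h1 := adjoint_isFormalAdjoint (dense_domain_of_starDMin_le hA) ⟨_, h⟩ ⟨_, hη⟩
    rw [(adjoint_le_starD hA).2 (x := ⟨_, h⟩) (y := ω) rfl,
      hA'.2 (x := ⟨_, hη⟩) (y := η) rfl] at h1
    exact sub_eq_zero.2 h1
  · intro h
    -- The maximal `⋆d` of `ω` represents the adjoint: vanishing of the Stokes pairing is exactly
    -- the adjoint relation.
    refine mem_adjoint_domain_of_exists _ ⟨starD D ω, fun x => ?_⟩
    have h1 := h ⟨x, hA'.1 x.2⟩ x.2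
    rw [hA'.2 (x := x) (y := ⟨x, hA'.1 x.2⟩) rfl]
    exact sub_eq_zero.1 h1

/-! ### Boundary conditions and self-adjointness -/

theorem starDOf_le_starD (L : Submodule ℝ (TraceSpace D)) : starDOf D L ≤ starD D :=
  LinearPMap.domRestrict_le

theorem eq_of_le_of_domain_eq {H : Type*} [AddCommGroup H] [Module ℝ H] {T A B : H →ₗ.[ℝ] H}
    (hA : A ≤ T) (hB : B ≤ T) (h : A.domain = B.domain) : A = B :=
  LinearPMap.eq_of_le_of_domain_eq ⟨h.le, fun x y hxy => by
    rw [hA.2 (y := ⟨x, hA.1 x.2⟩) rfl, hB.2 (y := ⟨x, hA.1 x.2⟩) hxy.symm]⟩ h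

theorem starDMin_le_starDOf (L : Submodule ℝ (TraceSpace D)) : starDMin D ≤ starDOf D L := by
  refine ⟨?_, fun x y hxy => ?_⟩
  · rw [starDMin_domain, starDOf_domain]
    exact W10_le_domainOf L
  · have h1 : starDMin D ≤ starD D := LinearPMap.domRestrict_le
    rw [h1.2 (y := ⟨x, h1.1 x.2⟩) rfl, (starDOf_le_starD L).2 (y := ⟨x, h1.1 x.2⟩) hxy.symm]

theorem coe_mem_domainOf {L : Submodule ℝ (TraceSpace D)} {ω : W1 D} :
    (ω : L2Form D) ∈ domainOf D L ↔ traceMap D ω ∈ L := by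
  simp [mem_domainOf]

open LinearPMap in
-- Since the trace maps onto the trace space, annihilating the domain under the Stokes pairing is
-- the same as having a trace in `L♯`. Both directions of the correspondence read off from this.
theorem mem_adjoint_starDOf_domain_iff (hb : Bornology.IsBounded (D : Set R3))
    (hL : HasLipschitzBoundary D) (L : Submodule ℝ (TraceSpace D)) (ω : W1 D) :
    (ω : L2Form D) ∈ (starDOf D L)†.domain ↔
      traceMap D ω ∈ sympOrthogonal (tracePairing D) L := by
  rw [mem_adjoint_domain_iff_stokesPairing (starDMin_le_starDOf L) (starDOf_le_starD L),
    starDOf_domain]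
  constructor
  · intro h v hv
    obtain ⟨η, rfl⟩ := traceMap_surjective v
    rw [tracePairing_traceMap hb hL]
    exact h η (coe_mem_domainOf.2 hv)
  · intro h η hη
    rw [← tracePairing_traceMap hb hL]
    exact h _ (coe_mem_domainOf.1 hη)

/-- `⋆d` with boundary condition `L` is self-adjoint if `L` is complete Lagrangian. -/
theorem isSelfAdjoint_starDOf (hb : Bornology.IsBounded (D : Set R3))
    (hL : HasLipschitzBoundary D) {L : Submodule ℝ (TraceSpace D)}
    (h : sympOrthogonal (tracePairing D) L = L) : IsSelfAdjoint (starDOf D L) := by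
  rw [LinearPMap.isSelfAdjoint_def]
  have hle := adjoint_le_starD (starDMin_le_starDOf L)
  refine eq_of_le_of_domain_eq hle (starDOf_le_starD L) ?_
  have hiff : ∀ ω : W1 D, (ω : L2Form D) ∈ (starDOf D L).adjoint.domain ↔
      (ω : L2Form D) ∈ (starDOf D L).domain := fun ω => by
    rw [mem_adjoint_starDOf_domain_iff hb hL, h, starDOf_domain, coe_mem_domainOf]
    rfl
  ext u
  exact ⟨fun hu => (hiff ⟨u, hle.1 hu⟩).1 hu,
    fun hu => (hiff ⟨u, (starDOf_le_starD L).1 hu⟩).2 hu⟩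

theorem sympOrthogonal_eq_of_isSelfAdjoint (hb : Bornology.IsBounded (D : Set R3))
    (hL : HasLipschitzBoundary D) {L : Submodule ℝ (TraceSpace D)}
    (h : IsSelfAdjoint (starDOf D L)) : sympOrthogonal (tracePairing D) L = L := by
  ext u
  obtain ⟨ω, rfl⟩ := traceMap_surjective u
  rw [← mem_adjoint_starDOf_domain_iff hb hL, LinearPMap.isSelfAdjoint_def.1 h, starDOf_domain,
    coe_mem_domainOf]
  rfl

/-- The domain determines `L`, because every element of the trace space is the trace of some form.
-/
theorem starDOf_injective : Function.Injective (starDOf D) := by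
  intro L L' h
  ext u
  obtain ⟨ω, rfl⟩ := traceMap_surjective u
  rw [← coe_mem_domainOf, ← coe_mem_domainOf, ← starDOf_domain, ← starDOf_domain, h]

/-- Each self-adjoint extension of the minimal operator is given by boundary conditions. -/
theorem exists_starDOf_eq (hb : Bornology.IsBounded (D : Set R3))
    (hL : HasLipschitzBoundary D) {A : L2Form D →ₗ.[ℝ] L2Form D} (hA : starDMin D ≤ A)
    (hsa : IsSelfAdjoint A) : ∃ L : Submodule ℝ (TraceSpace D), starDOf D L = A := by
  have hadj : A.adjoint = A := LinearPMap.isSelfAdjoint_def.1 hsa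
  have hA' : A ≤ starD D := hadj.symm.trans_le (adjoint_le_starD hA)
  -- A form of zero trace annihilates everything, so it lies in the domain of the adjoint, which is
  -- `A` itself.
  have hker : ∀ ω : W1 D, trace D ω = 0 → (ω : L2Form D) ∈ A.domain := fun ω hω => by
    rw [← hadj, mem_adjoint_domain_iff_stokesPairing hA hA']
    exact fun η _ => stokesPairing_eq_zero_of_trace_eq_zero hb hL hω η
  refine ⟨(A.domain.comap (W1 D).subtype).map (traceMap D),
    eq_of_le_of_domain_eq (starDOf_le_starD _) hA' ?_⟩
  rw [starDOf_domain]
  ext u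
  rw [mem_domainOf]
  constructor
  · rintro ⟨hu, η, hη, htr⟩
    -- Two forms with the same trace differ by an element of the kernel, which `A.domain` contains;
    -- hence `A.domain` is saturated for the trace.
    have h0 : trace D (⟨u, hu⟩ - η) = 0 := by
      rw [← traceMap_eq_zero_iff, map_sub, htr, sub_self]
    have h1 := A.domain.add_mem (hker _ h0) hη
    simpa using h1
  · intro hu
    exact ⟨hA'.1 hu, ⟨u, hA'.1 hu⟩, hu, rfl⟩

end CurlGKN

theorem mainTheorem10 (D : TopologicalSpace.Opens CurlGKN.R3)
    (hbounded : Bornology.IsBounded (D : Set CurlGKN.R3))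
    (hLipschitz : CurlGKN.HasLipschitzBoundary D) :
    (∀ ω η : CurlGKN.W1 D,
      CurlGKN.tracePairing D (CurlGKN.traceMap D ω) (CurlGKN.traceMap D η)
        = CurlGKN.stokesPairing D ω η) ∧
    CurlGKN.IsSymplecticPairing (CurlGKN.tracePairing D) ∧
    Set.BijOn (CurlGKN.starDOf D)
      {L | CurlGKN.IsCompleteLagrangian (CurlGKN.tracePairing D) L}
      {A | CurlGKN.IsSelfAdjointExtension (CurlGKN.starDMin D) A} := by
  refine ⟨CurlGKN.tracePairing_traceMap hbounded hLipschitz,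
    CurlGKN.isSymplecticPairing_tracePairing hbounded hLipschitz, fun L hL => ?_,
    CurlGKN.starDOf_injective.injOn, fun A hA => ?_⟩
  · exact ⟨CurlGKN.starDMin_le_starDOf L,
      CurlGKN.isSelfAdjoint_starDOf hbounded hLipschitz hL.2⟩
  · obtain ⟨L, rfl⟩ := CurlGKN.exists_starDOf_eq hbounded hLipschitz hA.1 hA.2
    have h := CurlGKN.sympOrthogonal_eq_of_isSelfAdjoint hbounded hLipschitz hA.2
    exact ⟨L, ⟨h.symm.subset, h⟩, rfl⟩
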